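/- Let $G\subseteq K_{m,n}$ be a connected bipartite graph with vertex set $V=U_1\sqcup U_2$, $|U_1|=m$, $|U_2|=n$, and $G\neq K_{1,1}$. Put $(1,-1):=\sum_{i} e_i-\sum_{j} f_j\in\mathbb Z^{m+n}$, $M_{\mathbb Q}:=(1,-1)^{\perp}\subseteq\mathbb Q^{m+n}$, $N:=\mathbb Z^{m+n}/\mathbb Z(1,-1)$ and $N_{\mathbb Q}:=\mathbb Q^{m+n}/\mathbb Q(1,-1)$, with the induced pairing $\langle\cdot,\cdot\rangle\colon M_{\mathbb Q}\times N_{\mathbb Q}\to\mathbb Q$. The dual edge cone $\sigma_G^\vee\subseteq M_{\mathbb Q}$ is the cone generated by the vectors $e^i+f^j$ for the edges $(i,j)$ of $G$, and the edge cone is $\sigma_G:=\{a\in N_{\mathbb Q}\mid \langle x,a\rangle\ge 0 \text{ for all } x\in\sigma_G^\vee\}$. Let $\sigma_G^{(1)}$ be the set of extremal rays (one-dimensional faces) of $\sigma_G$; the extremal generators of $\sigma_G$ are the primitive generators of these rays, i.e. the generators of the semigroups $\rho\cap N$, $\rho\in\sigma_G^{(1)}$. For a face $\tau$ of $\sigma_G^\vee$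 let $\tau^*:=\tau^\perp\cap\sigma_G$. An independent set is a nonempty set $A\subseteq V$ without adjacent vertices; write $A_i:=A\cap U_i$, and let $N(A)$ be the set of vertices adjacent to some vertex of $A$. It is one-sided if $A\subseteq U_1$ or $A\subseteq U_2$, and two-sided if $\emptyset\ne A_i\subsetneq U_i$ for $i=1,2$. For $A\subseteq V$ put $\mathcal H_A:=\{x\in M_{\mathbb Q}\mid \sum_{v\in A}x_v=\sum_{v\in N(A)}x_v\}$. The spanning subgraph $G\{A\}$ of $G$ associated to an independent set $A$ is the disjoint union of the induced subgraphs $G[A\sqcup N(A)]$ and $G[(U_i\setminus A)\sqcup(U_j\setminus N(A))]$ if $A\subseteq U_i$ is one-sided, $\{i,j\}=\{1,2\}$, and of $G[A_1\sqcup N(A_1)]$ and $G[A_2\sqcup N(A_2)]$ if $A$ is two-sided, together with all remaining vertices of $G$ as isolated vertices. Let $\mathcal I_G^{(*)}$ be the set consisting of the two-sided maximal independent sets and of the independent sets of the form $U_i\setminus\{u\}$, $u\in U_i$, that are contained in no two-sided independent set. A first independent set is an $A\in\mathcal I_G^{(*)}$ such that $G\{A\}$ has exactly two connected components; $\mathcal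 I_G^{(1)}$ denotes the set of first independent sets. Then for every $A\in\mathcal I_G^{(1)}$ and every $i\in\{1,2\}$ with $A_i\neq\emptyset$ the set $\mathcal H_{A_i}\cap\sigma_G^\vee$ is a facet of $\sigma_G^\vee$, and $$\pi\colon\mathcal I_G^{(1)}\longrightarrow\sigma_G^{(1)},\qquad A\longmapsto(\mathcal H_{A_i}\cap\sigma_G^\vee)^*\quad(A_i\ne\emptyset)$$ is well defined (independent of the choice of $i$) and bijective. Sending $A$ to the primitive generator of the ray $\pi(A)$ is a bijection from $\mathcal I_G^{(1)}$ onto the set of extremal generators of $\sigma_G$. -/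

import Mathlib

namespace EdgeCone

noncomputable section

/-! ### The lattices and vector spaces -/

/-- The vertex set of `K_{m,n}`. -/
abbrev Vert (m n : ℕ) : Type := Fin m ⊕ Fin n

/-- The vector `(1,…,1,-1,…,-1) = ∑ e_i - ∑ f_j`. -/
def oneNegOne (m n : ℕ) : Vert m n → ℚ := Sum.elim (fun _ => 1) (fun _ => -1)

/-- `M_ℚ`: the orthogonal complement of `(1,-1)` in `ℚ^{m+n}`. -/
def MQ (m n : ℕ) : Submodule ℚ (Vert m n → ℚ) :=
  LinearMap.ker (dotProductBilin ℚ ℚ (oneNegOne m n))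

/-- The line spanned by `(1,-1)`. -/
def minLine (m n : ℕ) : Submodule ℚ (Vert m n → ℚ) := Submodule.span ℚ {oneNegOne m n}

/-- `N_ℚ = ℚ^{m+n} / ⟨(1,-1)⟩`. -/
abbrev NQ (m n : ℕ) : Type := (Vert m n → ℚ) ⧸ minLine m n

theorem minLine_le_ker (m n : ℕ) :
    minLine m n ≤ LinearMap.ker
      ((dotProductBilin ℚ ℚ : (Vert m n → ℚ) →ₗ[ℚ] (Vert m n → ℚ) →ₗ[ℚ] ℚ).compl₂
        (MQ m n).subtype) := by
  rw [minLine, Submodule.span_le, Set.singleton_subset_iff]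
  ext x
  exact x.2

/-- The pairing `M_ℚ × N_ℚ → ℚ` induced by the standard scalar product of `ℚ^{m+n}`. -/
def pairing (m n : ℕ) : MQ m n →ₗ[ℚ] NQ m n →ₗ[ℚ] ℚ :=
  ((minLine m n).liftQ
    ((dotProductBilin ℚ ℚ : (Vert m n → ℚ) →ₗ[ℚ] (Vert m n → ℚ) →ₗ[ℚ] ℚ).compl₂
      (MQ m n).subtype) (minLine_le_ker m n)).flip

theorem pairing_apply_mk {m n : ℕ} (x : MQ m n) (a : Vert m n → ℚ) :
    pairing m n x (Submodule.Quotient.mk a) = ∑ v, a v * (x : Vert m n → ℚ) v := rfl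

/-- The lattice `N = ℤ^{m+n} / ⟨(1,-1)⟩`, as a subgroup of `N_ℚ`. -/
def latticeN (m n : ℕ) : AddSubgroup (NQ m n) :=
  ((minLine m n).mkQ.toAddMonoidHom.comp
    ((Int.castAddHom ℚ).compLeft (Vert m n))).range

/-! ### The edge cone and its dual -/

theorem edgeVector_mem {m n : ℕ} (i : Fin m) (j : Fin n) :
    (Pi.single (Sum.inl i) 1 + Pi.single (Sum.inr j) 1 : Vert m n → ℚ) ∈ MQ m n := by
  simp [MQ, oneNegOne]

/-- The vector `e^i + f^j ∈ M_ℚ`. -/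
def edgeVector {m n : ℕ} (i : Fin m) (j : Fin n) : MQ m n :=
  ⟨Pi.single (Sum.inl i) 1 + Pi.single (Sum.inr j) 1, edgeVector_mem i j⟩

/-- The dual edge cone `σ_G^∨ ⊆ M_ℚ`. -/
def dualEdgeCone {m n : ℕ} (G : SimpleGraph (Vert m n)) : PointedCone ℚ (MQ m n) :=
  PointedCone.hull ℚ {x | ∃ i j, G.Adj (Sum.inl i) (Sum.inr j) ∧ x = edgeVector i j}

/-- The edge cone `σ_G ⊆ N_ℚ`. -/
def edgeCone {m n : ℕ} (G : SimpleGraph (Vert m n)) : PointedCone ℚ (NQ m n) :=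
  PointedCone.dual (pairing m n) (dualEdgeCone G : Set (MQ m n))

/-- The dimension of a cone: the dimension of its linear span. -/
def coneDim {E : Type*} [AddCommGroup E] [Module ℚ E] (C : PointedCone ℚ E) : ℕ :=
  Module.finrank ℚ (Submodule.span ℚ (C : Set E))

/-- `F` is a facet of `C`: a face of codimension one. -/
def IsFacet {E : Type*} [AddCommGroup E] [Module ℚ E] (F C : PointedCone ℚ E) : Prop :=
  F.IsFaceOf C ∧ coneDim F + 1 = coneDim C

/-- `σ_G^{(1)}`: the extremal rays of the edge cone, i.e. its one-dimensional faces. -/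
def extremalRays {m n : ℕ} (G : SimpleGraph (Vert m n)) : Set (PointedCone ℚ (NQ m n)) :=
  {ρ | ρ.IsFaceOf (edgeCone G) ∧ coneDim ρ = 1}

/-- `v` is the (primitive) generator of the ray `ρ`: it generates the semigroup `ρ ∩ N`. -/
def IsRayGenerator {m n : ℕ} (ρ : PointedCone ℚ (NQ m n)) (v : NQ m n) : Prop :=
  (ρ : Set (NQ m n)) ∩ (latticeN m n : Set (NQ m n)) = Set.range (fun k : ℕ => k • v)

/-- The extremal (ray) generators of the edge cone. -/
def extremalGenerators {m n : ℕ} (G : SimpleGraph (Vert m n)) : Set (NQ m n) :=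
  {v | ∃ ρ ∈ extremalRays G, IsRayGenerator ρ v}

/-- `τ^* = τ^⊥ ∩ σ_G` for `τ ⊆ σ_G^∨`. -/
def dualFace {m n : ℕ} (G : SimpleGraph (Vert m n)) (τ : PointedCone ℚ (MQ m n)) :
    PointedCone ℚ (NQ m n) :=
  PointedCone.ofSubmodule
    (⨅ x ∈ τ, LinearMap.ker (pairing m n x)) ⊓ edgeCone G

theorem mem_dualFace {m n : ℕ} {G : SimpleGraph (Vert m n)} {τ : PointedCone ℚ (MQ m n)}
    {a : NQ m n} : a ∈ dualFace G τ ↔ (∀ x ∈ τ, pairing m n x a = 0) ∧ a ∈ edgeCone G := by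
  simp [dualFace]

/-! ### Independent sets -/

/-- The two sides `U_1`, `U_2` of the bipartition, indexed by `0`, `1`. -/
def U {m n : ℕ} : Fin 2 → Set (Vert m n) := ![Set.range Sum.inl, Set.range Sum.inr]

/-- Independent sets are nonempty by convention. -/
def IsIndep {m n : ℕ} (G : SimpleGraph (Vert m n)) (A : Set (Vert m n)) : Prop :=
  A.Nonempty ∧ G.IsIndepSet A

/-- The neighbor set `N(A)`. -/
def nbr {m n : ℕ} (G : SimpleGraph (Vert m n)) (A : Set (Vert m n)) : Set (Vert m n) :=
  {v | ∃ a ∈ A, G.Adj a v}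

/-- The linear form `x ↦ ∑_{v ∈ A} x_v` on `M_ℚ`. -/
def sumOver {m n : ℕ} (A : Set (Vert m n)) : MQ m n →ₗ[ℚ] ℚ :=
  (dotProductBilin ℚ ℚ (A.indicator 1)).comp (MQ m n).subtype

/-- The hyperplane `ℋ_A = {x ∈ M_ℚ | ∑_{v ∈ A} x_v = ∑_{v ∈ N(A)} x_v}`. -/
def hyperplane {m n : ℕ} (G : SimpleGraph (Vert m n)) (A : Set (Vert m n)) :
    Submodule ℚ (MQ m n) :=
  LinearMap.eqLocus (sumOver A) (sumOver (nbr G A))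

/-- `ℋ_A ∩ σ_G^∨`. -/
def hyperplaneFace {m n : ℕ} (G : SimpleGraph (Vert m n)) (A : Set (Vert m n)) :
    PointedCone ℚ (MQ m n) :=
  PointedCone.ofSubmodule (hyperplane G A) ⊓ dualEdgeCone G

/-- Two-sided independent sets: both `A ∩ U_i` are nonempty and proper in `U_i`. -/
def IsTwoSided {m n : ℕ} (G : SimpleGraph (Vert m n)) (A : Set (Vert m n)) : Prop :=
  IsIndep G A ∧ ∀ i, (A ∩ U i).Nonempty ∧ A ∩ U i ⊂ U i

/-- `G[S]` as a graph on all vertices (those outside `S` are isolated). -/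
def inducedOn {m n : ℕ} (G : SimpleGraph (Vert m n)) (S : Set (Vert m n)) :
    SimpleGraph (Vert m n) :=
  (G.induce S).spanningCoe

open Classical in
/-- The spanning subgraph `G{A}` associated to an independent set `A`. -/
def assocSubgraph {m n : ℕ} (G : SimpleGraph (Vert m n)) (A : Set (Vert m n)) :
    SimpleGraph (Vert m n) :=
  if A ⊆ U 0 then
    inducedOn G (A ∪ nbr G A) ⊔ inducedOn G ((U 0 \ A) ∪ (U 1 \ nbr G A))
  else if A ⊆ U 1 then
    inducedOn G (A ∪ nbr G A) ⊔ inducedOn G ((U 1 \ A) ∪ (U 0 \ nbr G A))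
  else
    inducedOn G ((A ∩ U 0) ∪ nbr G (A ∩ U 0)) ⊔ inducedOn G ((A ∩ U 1) ∪ nbr G (A ∩ U 1))

/-- `ℐ_G^{(*)}`: the two-sided maximal independent sets, and the (one-sided) independent sets
`U_i \ {u}` that are not contained in any two-sided independent set. -/
def starIndependentSets {m n : ℕ} (G : SimpleGraph (Vert m n)) : Set (Set (Vert m n)) :=
  {A | IsTwoSided G A ∧ Maximal (IsIndep G) A} ∪
  {A | IsIndep G A ∧ (∃ i, ∃ u ∈ U i, A = U i \ {u}) ∧ ¬ ∃ B, IsTwoSided G B ∧ A ⊆ B}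

/-- `ℐ_G^{(1)}`: the first independent sets. -/
def firstIndependentSets {m n : ℕ} (G : SimpleGraph (Vert m n)) : Set (Set (Vert m n)) :=
  {A ∈ starIndependentSets G | Nat.card (assocSubgraph G A).ConnectedComponent = 2}

end

end EdgeCone

/-! With the signs on `U_2` reversed, `N_ℚ` becomes the space of potentials `p` on `V` modulo
constants, and `e^i + f^j` pairs with `p` to the difference of its values at the two ends of the
edge. So `σ_G` consists of the potentials that do not increase from `U_1` to `U_2` along any edge.

Take a nonzero `p` on an extremal ray and a nontrivial strict superlevel set `C`. The indicator of
`C` is balanced on every tight edge of `p`, so `p` can be perturbed both ways along it inside the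
cone; extremality makes the two proportional modulo constants
(`exists_eq_smul_of_mem_extremalRays`). The same argument for the indicator of a component of the
uncut edges shows that both parts of the cut are connected. Conversely, if both parts are connected,
a potential balanced on the uncut edges is constant on each part, which leaves a single line.
Extremal rays thus correspond to connected cuts, and the 0-1 indicator is the primitive generator.

The involution `A ↦ A ∆ U_1` (`cutOf`) translates cuts into vertex sets: edges cross the cut in the
right direction exactly when no edge lies inside `A`. For `A` in `ℐ_G^{(*)}`, `nbr_inter_U` gives
`N(A_i) = U_j \ A`, so that `G{A}` is the graph of uncut edges and both `ℋ_{A_i}` equal the kernel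
of the cut vector. Conversely, connectedness of the two parts forces `A` to be maximal two-sided or
of the form `U_i \ {u}`; excluding `K_{1,1}` rules out `A = ∅`. -/

namespace EdgeCone

noncomputable section

variable {m n : ℕ}

/-! ### Points of `N_ℚ` as potentials on the vertices -/

/-- The class in `N_ℚ` of a potential `p`, with the signs of the second side reversed. In these
coordinates the line spanned by `(1,-1)` becomes the line of constant potentials. -/
def potentialClass (m n : ℕ) : (Vert m n → ℚ) →ₗ[ℚ] NQ m n :=
  (minLine m n).mkQ.comp (LinearMap.mulLeft ℚ (oneNegOne m n))

theorem oneNegOne_mul_self (m n : ℕ) : oneNegOne m n * oneNegOne m n = 1 := by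
  ext v
  cases v <;> simp [oneNegOne]

theorem potentialClass_surjective : Function.Surjective (potentialClass m n) := by
  intro x
  obtain ⟨a, rfl⟩ := (minLine m n).mkQ_surjective x
  refine ⟨oneNegOne m n * a, ?_⟩
  simp [potentialClass, ← mul_assoc, oneNegOne_mul_self]

theorem potentialClass_eq_zero_iff {p : Vert m n → ℚ} :
    potentialClass m n p = 0 ↔ ∃ c : ℚ, ∀ v, p v = c := by
  rw [potentialClass, LinearMap.comp_apply, Submodule.mkQ_apply, Submodule.Quotient.mk_eq_zero,
    minLine, Submodule.mem_span_singleton, LinearMap.mulLeft_apply]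
  constructor
  · rintro ⟨c, hc⟩
    refine ⟨c, fun v => ?_⟩
    have := congrFun hc v
    cases v <;> simpa [oneNegOne, eq_comm] using this
  · rintro ⟨c, hc⟩
    refine ⟨c, ?_⟩
    ext v
    simp [hc, mul_comm]

theorem potentialClass_eq_iff {p q : Vert m n → ℚ} :
    potentialClass m n p = potentialClass m n q ↔ ∃ c : ℚ, ∀ v, p v = q v + c := by
  rw [← sub_eq_zero, ← map_sub, potentialClass_eq_zero_iff]
  simp [sub_eq_iff_eq_add, add_comm]

theorem pairing_potentialClass (x : MQ m n) (p : Vert m n → ℚ) :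
    pairing m n x (potentialClass m n p) =
      ∑ i, p (Sum.inl i) * (x : Vert m n → ℚ) (Sum.inl i) -
        ∑ j, p (Sum.inr j) * (x : Vert m n → ℚ) (Sum.inr j) := by
  change ∑ v, (oneNegOne m n v * p v) * (x : Vert m n → ℚ) v = _
  simp [oneNegOne, sub_eq_add_neg]

theorem pairing_edgeVector (i : Fin m) (j : Fin n) (p : Vert m n → ℚ) :
    pairing m n (edgeVector i j) (potentialClass m n p) = p (Sum.inl i) - p (Sum.inr j) := by
  simp [pairing_potentialClass, edgeVector, Pi.single_apply]

/-- Every linear form on `M_ℚ` is given by a potential. -/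
theorem exists_potential (f : MQ m n →ₗ[ℚ] ℚ) :
    ∃ p, f = (pairing m n).flip (potentialClass m n p) := by
  obtain ⟨g, hg⟩ := LinearMap.exists_extend f
  obtain ⟨p, hp⟩ := potentialClass_surjective
    ((minLine m n).mkQ (fun v => g (Pi.single v 1)))
  refine ⟨p, ?_⟩
  ext x
  rw [LinearMap.flip_apply, hp, Submodule.mkQ_apply, pairing_apply_mk, ← hg]
  change g (x : Vert m n → ℚ) = _
  conv_lhs => rw [← Finset.univ_sum_single (x : Vert m n → ℚ), map_sum]
  refine Finset.sum_congr rfl fun v _ => ?_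
  have : (Pi.single v ((x : Vert m n → ℚ) v) : Vert m n → ℚ) =
      (x : Vert m n → ℚ) v • Pi.single v 1 := by
    rw [← Pi.single_smul]; simp
  rw [this, map_smul, smul_eq_mul, mul_comm]

theorem edgeVector_mem_dualEdgeCone {G : SimpleGraph (Vert m n)} {i : Fin m} {j : Fin n}
    (h : G.Adj (Sum.inl i) (Sum.inr j)) : edgeVector i j ∈ dualEdgeCone G :=
  PointedCone.subset_hull ⟨i, j, h, rfl⟩

/-- Nonnegativity need only be tested on the generators `e^i + f^j`, which turns the cone into a
system of inequalities between potential values. -/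
theorem potentialClass_mem_edgeCone {G : SimpleGraph (Vert m n)} {p : Vert m n → ℚ} :
    potentialClass m n p ∈ edgeCone G ↔
      ∀ i j, G.Adj (Sum.inl i) (Sum.inr j) → p (Sum.inr j) ≤ p (Sum.inl i) := by
  rw [edgeCone, dualEdgeCone, PointedCone.dual_hull, PointedCone.mem_dual]
  constructor
  · intro h i j hij
    have := h ⟨i, j, hij, rfl⟩
    rwa [pairing_edgeVector, sub_nonneg] at this
  · rintro h _ ⟨i, j, hij, rfl⟩
    rw [pairing_edgeVector, sub_nonneg]
    exact h i j hij

/-! ### Connected cuts -/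

/-- The spanning subgraph of `G` formed by the edges that do not cross the cut `(C, Cᶜ)`. -/
def cutGraph (G : SimpleGraph (Vert m n)) (C : Set (Vert m n)) : SimpleGraph (Vert m n) :=
  inducedOn G C ⊔ inducedOn G Cᶜ

theorem inducedOn_adj {G : SimpleGraph (Vert m n)} {S : Set (Vert m n)} {u v : Vert m n} :
    (inducedOn G S).Adj u v ↔ G.Adj u v ∧ u ∈ S ∧ v ∈ S := by
  constructor
  · rintro ⟨-, ⟨a, ha⟩, ⟨b, hb⟩, h, rfl, rfl⟩
    exact ⟨h, ha, hb⟩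
  · rintro ⟨h, hu, hv⟩
    exact ⟨h.ne, ⟨u, hu⟩, ⟨v, hv⟩, h, rfl, rfl⟩

theorem cutGraph_adj {G : SimpleGraph (Vert m n)} {C : Set (Vert m n)} {u v : Vert m n} :
    (cutGraph G C).Adj u v ↔ G.Adj u v ∧ (u ∈ C ↔ v ∈ C) := by
  simp only [cutGraph, SimpleGraph.sup_adj, inducedOn_adj, Set.mem_compl_iff]
  tauto

/-- A nontrivial cut of `G` with two connected parts, such that all edges crossing the cut
go from `C ∩ U_1` to `Cᶜ ∩ U_2`. -/
structure IsConnectedCut (G : SimpleGraph (Vert m n)) (C : Set (Vert m n)) : Prop where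
  nonempty : C.Nonempty
  nonempty_compl : Cᶜ.Nonempty
  directed : ∀ i j, G.Adj (Sum.inl i) (Sum.inr j) → Sum.inr j ∈ C → Sum.inl i ∈ C
  reachable : ∀ u v, (u ∈ C ↔ v ∈ C) → (cutGraph G C).Reachable u v

theorem exists_eq_inl_inr_of_adj {G : SimpleGraph (Vert m n)}
    (hG : G ≤ completeBipartiteGraph (Fin m) (Fin n)) {u v : Vert m n} (h : G.Adj u v) :
    (∃ i j, u = Sum.inl i ∧ v = Sum.inr j) ∨ ∃ i j, u = Sum.inr j ∧ v = Sum.inl i := by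
  have := hG h
  rcases u with i | j <;> rcases v with i' | j' <;> simp_all

theorem apply_eq_of_reachable {V α : Type*} {G : SimpleGraph V} {p : V → α}
    (h : ∀ u v, G.Adj u v → p u = p v) {u v : V} (huv : G.Reachable u v) : p u = p v := by
  obtain ⟨w⟩ := huv
  induction w with
  | nil => rfl
  | cons hadj _ ih => exact (h _ _ hadj).trans ih

theorem apply_eq_of_adj {α : Type*} {G : SimpleGraph (Vert m n)}
    (hG : G ≤ completeBipartiteGraph (Fin m) (Fin n)) {p : Vert m n → α}
    (h : ∀ i j, G.Adj (Sum.inl i) (Sum.inr j) → p (Sum.inl i) = p (Sum.inr j)) {u v : Vert m n}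
    (huv : G.Adj u v) : p u = p v := by
  rcases exists_eq_inl_inr_of_adj hG huv with ⟨i, j, rfl, rfl⟩ | ⟨i, j, rfl, rfl⟩
  · exact h i j huv
  · exact (h i j huv.symm).symm

/-- A potential that is balanced on all edges of a connected graph is constant. -/
theorem potentialClass_eq_zero_of_connected {G : SimpleGraph (Vert m n)}
    (hG : G ≤ completeBipartiteGraph (Fin m) (Fin n)) (hconn : G.Connected) {p : Vert m n → ℚ}
    (h : ∀ i j, G.Adj (Sum.inl i) (Sum.inr j) → p (Sum.inl i) = p (Sum.inr j)) :
    potentialClass m n p = 0 := by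
  obtain ⟨v₀⟩ := hconn.nonempty
  exact potentialClass_eq_zero_iff.2 ⟨p v₀, fun v =>
    apply_eq_of_reachable (fun _ _ => apply_eq_of_adj hG h) (hconn.preconnected v v₀)⟩

/-- The candidate ray generator attached to a cut. -/
def cutVector (C : Set (Vert m n)) : NQ m n := potentialClass m n (C.indicator 1)

/-- The ray spanned by `cutVector C`. -/
def cutRay (C : Set (Vert m n)) : PointedCone ℚ (NQ m n) := PointedCone.hull ℚ {cutVector C}

theorem mem_cutRay {C : Set (Vert m n)} {x : NQ m n} :
    x ∈ cutRay C ↔ ∃ c : ℚ, 0 ≤ c ∧ x = c • cutVector C := by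
  rw [cutRay, PointedCone.hull, Submodule.mem_span_singleton]
  constructor
  · rintro ⟨c, rfl⟩
    exact ⟨c, c.2, rfl⟩
  · rintro ⟨c, hc, rfl⟩
    exact ⟨⟨c, hc⟩, rfl⟩

theorem cutVector_mem_edgeCone {G : SimpleGraph (Vert m n)} {C : Set (Vert m n)}
    (h : ∀ i j, G.Adj (Sum.inl i) (Sum.inr j) → Sum.inr j ∈ C → Sum.inl i ∈ C) :
    cutVector C ∈ edgeCone G := by
  refine potentialClass_mem_edgeCone.2 fun i j hij => ?_
  by_cases hj : Sum.inr j ∈ C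
  · simp [hj, h i j hij hj]
  · rw [Set.indicator_of_notMem hj]
    exact Set.indicator_nonneg (fun _ _ => zero_le_one) _

theorem cutVector_ne_zero {C : Set (Vert m n)} (h : C.Nonempty) (h' : Cᶜ.Nonempty) :
    cutVector C ≠ 0 := by
  obtain ⟨u, hu⟩ := h
  obtain ⟨v, hv⟩ := h'
  intro h0
  obtain ⟨c, hc⟩ := potentialClass_eq_zero_iff.1 h0
  have h1 := hc u
  have h2 := hc v
  rw [Set.indicator_of_mem hu] at h1
  rw [Set.indicator_of_notMem hv] at h2
  simp [← h2] at h1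

theorem cutVector_inj {C D : Set (Vert m n)} (hC : C.Nonempty) (hC' : Cᶜ.Nonempty)
    (hD : D.Nonempty) (hD' : Dᶜ.Nonempty) (h : cutVector C = cutVector D) : C = D := by
  classical
  obtain ⟨c, hc⟩ := potentialClass_eq_iff.1 h
  have key : ∀ v, (if v ∈ C then (1 : ℚ) else 0) = (if v ∈ D then 1 else 0) + c := by
    simpa [Set.indicator_apply] using hc
  obtain ⟨u, hu⟩ := hC
  obtain ⟨u', hu'⟩ := hC'
  obtain ⟨w, hw⟩ := hD
  obtain ⟨w', hw'⟩ := hD'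
  -- Both indicators take both values 0 and 1, so neither a positive nor a negative shift is
  -- possible.
  have hc0 : c = 0 := by
    have h1 := key u
    have h2 := key u'
    have h3 := key w
    have h4 := key w'
    rw [if_pos hu] at h1
    rw [if_neg hu'] at h2
    rw [if_pos hw] at h3
    rw [if_neg hw'] at h4
    split_ifs at h1 h2 h3 h4 <;> linarith
  ext v
  have := key v
  by_cases h1 : v ∈ C <;> by_cases h2 : v ∈ D <;> simp_all

namespace IsConnectedCut

variable {G : SimpleGraph (Vert m n)} {C : Set (Vert m n)}

/-- A potential that is balanced on the uncut edges is a combination of the indicator of the cut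
and a constant. -/
theorem exists_potentialClass_eq_smul (hC : IsConnectedCut G C)
    (hG : G ≤ completeBipartiteGraph (Fin m) (Fin n)) {p : Vert m n → ℚ}
    (h : ∀ i j, G.Adj (Sum.inl i) (Sum.inr j) → (Sum.inl i ∈ C ↔ Sum.inr j ∈ C) →
      p (Sum.inl i) = p (Sum.inr j)) :
    ∃ c : ℚ, potentialClass m n p = c • cutVector C := by
  obtain ⟨u, hu⟩ := hC.nonempty
  obtain ⟨w, hw⟩ := hC.nonempty_compl
  have hle : cutGraph G C ≤ completeBipartiteGraph (Fin m) (Fin n) :=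
    fun _ _ h => hG (cutGraph_adj.1 h).1
  have key : ∀ a b, (a ∈ C ↔ b ∈ C) → p a = p b := fun a b hab =>
    apply_eq_of_reachable (fun _ _ => apply_eq_of_adj hle fun i j hij =>
      h i j (cutGraph_adj.1 hij).1 (cutGraph_adj.1 hij).2) (hC.reachable a b hab)
  refine ⟨p u - p w, ?_⟩
  rw [cutVector, ← map_smul, potentialClass_eq_iff]
  refine ⟨p w, fun v => ?_⟩
  by_cases hv : v ∈ C
  · simp [hv, key v u (by simp [hv, hu])]
  · rw [key v w (iff_of_false hv hw)]
    simp [hv]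

/-- In a connected graph some edge crosses the cut. -/
theorem exists_crossing (hC : IsConnectedCut G C)
    (hG : G ≤ completeBipartiteGraph (Fin m) (Fin n)) (hconn : G.Connected) :
    ∃ i j, G.Adj (Sum.inl i) (Sum.inr j) ∧ Sum.inl i ∈ C ∧ Sum.inr j ∉ C := by
  by_contra! hno
  refine cutVector_ne_zero hC.nonempty hC.nonempty_compl
    (potentialClass_eq_zero_of_connected hG hconn fun i j hij => ?_)
  by_cases hi : Sum.inl i ∈ C
  · simp [hi, hno i j hij hi]
  · have hj : Sum.inr j ∉ C := fun hj => hi (hC.directed i j hij hj)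
    simp [hi, hj]

theorem nonneg_of_smul_cutVector_mem (hC : IsConnectedCut G C)
    (hG : G ≤ completeBipartiteGraph (Fin m) (Fin n)) (hconn : G.Connected) {c : ℚ}
    (h : c • cutVector C ∈ edgeCone G) : 0 ≤ c := by
  obtain ⟨i, j, hij, hi, hj⟩ := hC.exists_crossing hG hconn
  rw [cutVector, ← map_smul, potentialClass_mem_edgeCone] at h
  simpa [hi, hj] using h i j hij

/-- The ray of a connected cut consists of the points of the edge cone that are balanced on the
uncut edges. -/
theorem mem_cutRay_of_balanced (hC : IsConnectedCut G C)
    (hG : G ≤ completeBipartiteGraph (Fin m) (Fin n)) (hconn : G.Connected) {p : Vert m n → ℚ}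
    (hp : potentialClass m n p ∈ edgeCone G)
    (h : ∀ i j, G.Adj (Sum.inl i) (Sum.inr j) → (Sum.inl i ∈ C ↔ Sum.inr j ∈ C) →
      p (Sum.inl i) = p (Sum.inr j)) : potentialClass m n p ∈ cutRay C := by
  obtain ⟨c, hc⟩ := hC.exists_potentialClass_eq_smul hG h
  rw [hc] at hp
  exact mem_cutRay.2 ⟨c, hC.nonneg_of_smul_cutVector_mem hG hconn hp, hc⟩

theorem coneDim_cutRay (hC : C.Nonempty) (hC' : Cᶜ.Nonempty) : coneDim (cutRay C) = 1 := by
  rw [coneDim, cutRay, PointedCone.hull, Submodule.span_span_of_tower,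
    finrank_span_singleton (cutVector_ne_zero hC hC')]

/-- If `a • x + y` lies on the ray with `x`, `y` in the cone and `a > 0`, the differences of `x` and
`y` along an uncut edge are nonnegative and have weighted sum zero. Hence `x` is balanced on the
uncut edges, and connectedness of the parts puts it on the ray. -/
theorem cutRay_mem_extremalRays (hC : IsConnectedCut G C)
    (hG : G ≤ completeBipartiteGraph (Fin m) (Fin n)) (hconn : G.Connected) :
    cutRay C ∈ extremalRays G := by
  refine ⟨⟨fun x hx => ?_, ?_⟩, coneDim_cutRay hC.nonempty hC.nonempty_compl⟩
  · obtain ⟨c, hc, rfl⟩ := mem_cutRay.1 hx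
    exact PointedCone.smul_mem _ hc (cutVector_mem_edgeCone hC.directed)
  · intro x y a hx hy ha hxy
    obtain ⟨p, rfl⟩ := potentialClass_surjective x
    obtain ⟨q, rfl⟩ := potentialClass_surjective y
    obtain ⟨c, hc, h⟩ := mem_cutRay.1 hxy
    refine hC.mem_cutRay_of_balanced hG hconn hx fun i j hij hcut => ?_
    rw [cutVector, ← map_smul, ← map_smul, ← map_add, potentialClass_eq_iff] at h
    obtain ⟨d, hd⟩ := h
    have h1 := hd (Sum.inl i)
    have h2 := hd (Sum.inr j)
    have h3 : C.indicator (1 : Vert m n → ℚ) (Sum.inl i) = C.indicator 1 (Sum.inr j) := by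
      classical simp [Set.indicator_apply, hcut]
    simp only [Pi.add_apply, Pi.smul_apply, smul_eq_mul, h3] at h1 h2
    have h4 := potentialClass_mem_edgeCone.1 hx i j hij
    have h5 := potentialClass_mem_edgeCone.1 hy i j hij
    have h6 : a * (p (Sum.inl i) - p (Sum.inr j)) ≤ 0 := by linarith
    have h7 := nonpos_of_mul_nonpos_right h6 ha
    linarith

end IsConnectedCut

/-! ### Every extremal ray comes from a connected cut -/

/-- A potential may be perturbed inside the edge cone along directions that are balanced on its
tight edges. -/
theorem exists_perturbation {G : SimpleGraph (Vert m n)} {p b : Vert m n → ℚ}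
    (hp : potentialClass m n p ∈ edgeCone G)
    (hb : ∀ i j, G.Adj (Sum.inl i) (Sum.inr j) → p (Sum.inl i) = p (Sum.inr j) →
      b (Sum.inl i) = b (Sum.inr j)) :
    ∃ ε : ℚ, 0 < ε ∧ potentialClass m n (p + ε • b) ∈ edgeCone G ∧
      potentialClass m n (p - ε • b) ∈ edgeCone G := by
  -- There are finitely many edges: tight ones stay tight for every `ε`, and the others have slack
  -- that survives for small `ε`.
  have key : ∀ᶠ ε in nhdsWithin (0 : ℚ) (Set.Ioi 0), ∀ e : Fin m × Fin n,
      G.Adj (Sum.inl e.1) (Sum.inr e.2) →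
        0 ≤ p (Sum.inl e.1) - p (Sum.inr e.2) + ε * (b (Sum.inl e.1) - b (Sum.inr e.2)) ∧
        0 ≤ p (Sum.inl e.1) - p (Sum.inr e.2) - ε * (b (Sum.inl e.1) - b (Sum.inr e.2)) := by
    refine Filter.eventually_all.2 fun e => ?_
    by_cases he : G.Adj (Sum.inl e.1) (Sum.inr e.2)
    swap
    · exact Filter.Eventually.of_forall fun _ h => absurd h he
    rcases (potentialClass_mem_edgeCone.1 hp _ _ he).eq_or_lt with h | h
    · exact Filter.Eventually.of_forall fun ε _ => by
        simp [h, hb _ _ he h.symm]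
    · refine Filter.Eventually.filter_mono nhdsWithin_le_nhds ?_
      have h1 : ContinuousAt (fun ε : ℚ => p (Sum.inl e.1) - p (Sum.inr e.2) +
          ε * (b (Sum.inl e.1) - b (Sum.inr e.2))) 0 := by fun_prop
      have h2 : ContinuousAt (fun ε : ℚ => p (Sum.inl e.1) - p (Sum.inr e.2) -
          ε * (b (Sum.inl e.1) - b (Sum.inr e.2))) 0 := by fun_prop
      filter_upwards [h1.eventually (lt_mem_nhds (a := 0) (by simpa using h)),
        h2.eventually (lt_mem_nhds (a := 0) (by simpa using h))] with ε h3 h4 _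
      exact ⟨h3.le, h4.le⟩
  obtain ⟨ε, hε, hpos⟩ := (key.and self_mem_nhdsWithin).exists
  refine ⟨ε, hpos, potentialClass_mem_edgeCone.2 fun i j hij => ?_,
    potentialClass_mem_edgeCone.2 fun i j hij => ?_⟩
  · have := (hε (i, j) hij).1
    simp only [Pi.add_apply, Pi.smul_apply, smul_eq_mul]
    linarith
  · have := (hε (i, j) hij).2
    simp only [Pi.sub_apply, Pi.smul_apply, smul_eq_mul]
    linarith

theorem exists_eq_smul_of_coneDim_eq_one {E : Type*} [AddCommGroup E] [Module ℚ E]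
    {ρ : PointedCone ℚ E} (h : coneDim ρ = 1) {x y : E} (hx : x ∈ ρ) (hx0 : x ≠ 0)
    (hy : y ∈ ρ) : ∃ c : ℚ, y = c • x := by
  have hx' := Submodule.subset_span (R := ℚ) (s := (ρ : Set E)) hx
  have hy' := Submodule.subset_span (R := ℚ) (s := (ρ : Set E)) hy
  obtain ⟨c, hc⟩ := (finrank_eq_one_iff_of_nonzero' (⟨x, hx'⟩ : Submodule.span ℚ (ρ : Set E))
    (by simpa [Subtype.ext_iff] using hx0)).1 h ⟨y, hy'⟩
  exact ⟨c, (congrArg Subtype.val hc).symm⟩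

theorem exists_ne_zero_of_coneDim_eq_one {E : Type*} [AddCommGroup E] [Module ℚ E]
    {ρ : PointedCone ℚ E} (h : coneDim ρ = 1) : ∃ x ∈ ρ, x ≠ 0 := by
  by_contra! h0
  have : Submodule.span ℚ (ρ : Set E) = ⊥ := Submodule.span_eq_bot.2 h0
  rw [coneDim, this, finrank_bot] at h
  exact zero_ne_one h

/-- A direction that is balanced on the tight edges of a nonzero point of an extremal ray lies in
the line spanned by that point. -/
theorem exists_eq_smul_of_mem_extremalRays {G : SimpleGraph (Vert m n)}
    {ρ : PointedCone ℚ (NQ m n)} (hρ : ρ ∈ extremalRays G) {p b : Vert m n → ℚ}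
    (hp : potentialClass m n p ∈ ρ) (hp0 : potentialClass m n p ≠ 0)
    (hb : ∀ i j, G.Adj (Sum.inl i) (Sum.inr j) → p (Sum.inl i) = p (Sum.inr j) →
      b (Sum.inl i) = b (Sum.inr j)) :
    ∃ c : ℚ, potentialClass m n b = c • potentialClass m n p := by
  obtain ⟨hface, hdim⟩ := hρ
  obtain ⟨ε, hε, h1, h2⟩ := exists_perturbation (hface.le hp) hb
  have h3 : potentialClass m n (p + ε • b) ∈ ρ := by
    -- The two perturbed points add up to twice the class of `p`, which lies in the face.
    refine hface.mem_of_add_mem_left h1 h2 ?_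
    rw [← map_add, show p + ε • b + (p - ε • b) = p + p by abel, map_add]
    exact add_mem hp hp
  obtain ⟨c, hc⟩ := exists_eq_smul_of_coneDim_eq_one hdim hp hp0 h3
  refine ⟨ε⁻¹ * (c - 1), ?_⟩
  rw [map_add, map_smul] at hc
  rw [mul_smul, sub_smul, one_smul, ← hc, add_sub_cancel_left, smul_smul,
    inv_mul_cancel₀ hε.ne', one_smul]

theorem exists_isConnectedCut_of_mem_extremalRays {G : SimpleGraph (Vert m n)}
    (hG : G ≤ completeBipartiteGraph (Fin m) (Fin n)) (hconn : G.Connected)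
    {ρ : PointedCone ℚ (NQ m n)} (hρ : ρ ∈ extremalRays G) :
    ∃ C, IsConnectedCut G C ∧ ρ = cutRay C := by
  classical
  obtain ⟨x, hx, hx0⟩ := exists_ne_zero_of_coneDim_eq_one hρ.2
  obtain ⟨p, rfl⟩ := potentialClass_surjective x
  obtain ⟨u, v, huv⟩ : ∃ u v, p u < p v := by
    by_contra! h
    obtain ⟨v₀⟩ := hconn.nonempty
    exact hx0 (potentialClass_eq_zero_iff.2 ⟨p v₀, fun v => le_antisymm (h _ _) (h _ _)⟩)
  -- A strict superlevel set at the level of `u` contains `v` but not `u`, and ends of a tight edge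
  -- of `p` are never separated by it.
  set C : Set (Vert m n) := {w | p u < p w} with hCdef
  have hne : C.Nonempty := ⟨v, huv⟩
  have hne' : Cᶜ.Nonempty := ⟨u, by simp [hCdef]⟩
  have hdir : ∀ i j, G.Adj (Sum.inl i) (Sum.inr j) → Sum.inr j ∈ C → Sum.inl i ∈ C :=
    fun i j hij hj => lt_of_lt_of_le hj (potentialClass_mem_edgeCone.1 (hρ.1.le hx) i j hij)
  obtain ⟨c, hc⟩ := exists_eq_smul_of_mem_extremalRays hρ (b := C.indicator 1) hx hx0 (by
    intro i j _ h
    simp [Set.indicator_apply, hCdef, h])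
  -- Comparing the values at `u` and `v` gives `1 = c * (p v - p u)`.
  have hcpos : 0 < c := by
    rw [← map_smul, potentialClass_eq_iff] at hc
    obtain ⟨d, hd⟩ := hc
    have h1 := hd u
    have h2 := hd v
    simp only [Set.indicator_apply, hCdef, Set.mem_ofPred_eq, lt_irrefl, if_false, huv, if_true,
      Pi.one_apply, Pi.smul_apply, smul_eq_mul] at h1 h2
    have h3 : 0 < c * (p v - p u) := by linarith
    exact pos_of_mul_pos_left h3 (by linarith)
  have hCρ : cutVector C ∈ ρ := by
    rw [cutVector, hc]
    exact PointedCone.smul_mem _ hcpos.le hx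
  have hcut : IsConnectedCut G C := by
    refine ⟨hne, hne', hdir, fun a b hab => ?_⟩
    -- The indicator of the component of `a` in the cut graph is balanced on the tight edges of the
    -- cut vector, hence takes equal values at `a` and `b`, which lie in the same part.
    obtain ⟨d, hd⟩ := exists_eq_smul_of_mem_extremalRays hρ
      (b := {w | (cutGraph G C).Reachable a w}.indicator 1) hCρ
      (cutVector_ne_zero hne hne') (by
        intro i j hij h
        have hiff : Sum.inl i ∈ C ↔ Sum.inr j ∈ C := by
          by_cases h1 : Sum.inl i ∈ C <;> by_cases h2 : Sum.inr j ∈ C <;>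
            simp [h1, h2] at h ⊢
        have hadj : (cutGraph G C).Adj (Sum.inl i) (Sum.inr j) := cutGraph_adj.2 ⟨hij, hiff⟩
        have : (cutGraph G C).Reachable a (Sum.inl i) ↔ (cutGraph G C).Reachable a (Sum.inr j) :=
          ⟨fun h => h.trans hadj.reachable, fun h => h.trans hadj.symm.reachable⟩
        simp [Set.indicator_apply, this])
    rw [← map_smul, potentialClass_eq_iff] at hd
    obtain ⟨e, he⟩ := hd
    have h1 := he a
    have h2 := he b
    by_contra hab'
    simp [Set.indicator_apply, hab, hab'] at h1 h2
    linarith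
  refine ⟨C, hcut, le_antisymm (fun y hy => ?_) ?_⟩
  · obtain ⟨d, rfl⟩ := exists_eq_smul_of_coneDim_eq_one hρ.2 hCρ (cutVector_ne_zero hne hne') hy
    exact mem_cutRay.2
      ⟨d, hcut.nonneg_of_smul_cutVector_mem hG hconn (hρ.1.le hy), rfl⟩
  · exact Submodule.span_le.2 (by simpa using hCρ)

/-! ### Primitive generators -/

/-- A lattice point has a potential with integer values, and its scale on the ray is the difference
of the values inside and outside `C`, hence an integer. -/
theorem isRayGenerator_cutVector {C : Set (Vert m n)} (hC : C.Nonempty) (hC' : Cᶜ.Nonempty) :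
    IsRayGenerator (cutRay C) (cutVector C) := by
  classical
  ext x
  constructor
  · rintro ⟨hx, z, rfl⟩
    obtain ⟨c, hc, h⟩ := mem_cutRay.1 hx
    obtain ⟨u, hu⟩ := hC
    obtain ⟨w, hw⟩ := hC'
    have hz : ((minLine m n).mkQ.toAddMonoidHom.comp
        ((Int.castAddHom ℚ).compLeft (Vert m n))) z =
        potentialClass m n (oneNegOne m n * fun v => (z v : ℚ)) := by
      simp only [potentialClass, LinearMap.comp_apply, LinearMap.mulLeft_apply, ← mul_assoc,
        oneNegOne_mul_self, one_mul]
      rfl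
    rw [hz] at h ⊢
    have h' := h
    rw [cutVector, ← map_smul, potentialClass_eq_iff] at h
    obtain ⟨d, hd⟩ := h
    have hint : ∀ v, ∃ k : ℤ, oneNegOne m n v * (z v : ℚ) = k := by
      rintro (i | j)
      · exact ⟨z (Sum.inl i), by simp [oneNegOne]⟩
      · exact ⟨-z (Sum.inr j), by simp [oneNegOne]⟩
    obtain ⟨k, hk⟩ := hint u
    obtain ⟨l, hl⟩ := hint w
    have h1 := hd u
    have h2 := hd w
    rw [Set.mem_compl_iff] at hw
    simp only [Pi.mul_apply, hk, hl, Pi.smul_apply, Set.indicator_apply, hu, hw, if_true, if_false,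
      Pi.one_apply, smul_eq_mul, mul_one, mul_zero, zero_add] at h1 h2
    have hckl : c = ((k - l : ℤ) : ℚ) := by push_cast; linarith
    have hnn : 0 ≤ k - l := by rw [hckl] at hc; exact_mod_cast hc
    obtain ⟨r, hr⟩ := Int.eq_ofNat_of_zero_le hnn
    refine ⟨r, ?_⟩
    rw [h', hckl, hr, Int.cast_natCast, Nat.cast_smul_eq_nsmul]
  · rintro ⟨k, rfl⟩
    refine ⟨mem_cutRay.2 ⟨k, by positivity, (Nat.cast_smul_eq_nsmul ℚ k _).symm⟩, ?_⟩
    refine AddSubgroup.nsmul_mem _ ?_ _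
    refine ⟨fun v => if v ∈ C then Sum.elim (fun _ => 1) (fun _ => -1) v else 0, ?_⟩
    change (minLine m n).mkQ _ = (minLine m n).mkQ _
    congr 1
    ext v
    by_cases hv : v ∈ C <;> cases v <;> simp [hv, oneNegOne]

theorem IsRayGenerator.unique {ρ : PointedCone ℚ (NQ m n)} {v w : NQ m n}
    (hv : IsRayGenerator ρ v) (hw : IsRayGenerator ρ w) : v = w := by
  have h : Set.range (fun k : ℕ => k • v) = Set.range (fun k : ℕ => k • w) := hv.symm.trans hw
  obtain ⟨k, hk⟩ : v ∈ Set.range (fun k : ℕ => k • w) := h ▸ ⟨1, one_smul _ _⟩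
  obtain ⟨l, hl⟩ : w ∈ Set.range (fun k : ℕ => k • v) := h.symm ▸ ⟨1, one_smul _ _⟩
  simp only at hk hl
  by_cases hw0 : w = 0
  · rw [← hk, hw0, smul_zero]
  · have h1 : ((l * k : ℕ) : ℚ) • w = (1 : ℚ) • w := by
      rw [Nat.cast_smul_eq_nsmul, mul_smul, hk, hl, one_smul]
    have h2 : l * k = 1 := by exact_mod_cast smul_left_injective ℚ hw0 h1
    rw [← hk, Nat.eq_one_of_mul_eq_one_left h2, one_smul]

/-! ### Facets of the dual edge cone -/

/-- The face of the dual edge cone cut out by a connected cut. -/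
def cutFace (G : SimpleGraph (Vert m n)) (C : Set (Vert m n)) : PointedCone ℚ (MQ m n) :=
  PointedCone.ofSubmodule (LinearMap.ker ((pairing m n).flip (cutVector C))) ⊓ dualEdgeCone G

theorem mem_cutFace {G : SimpleGraph (Vert m n)} {C : Set (Vert m n)} {x : MQ m n} :
    x ∈ cutFace G C ↔ pairing m n x (cutVector C) = 0 ∧ x ∈ dualEdgeCone G := by
  simp [cutFace]

theorem edgeVector_mem_cutFace {G : SimpleGraph (Vert m n)} {C : Set (Vert m n)} {i : Fin m}
    {j : Fin n} (hij : G.Adj (Sum.inl i) (Sum.inr j)) (h : Sum.inl i ∈ C ↔ Sum.inr j ∈ C) :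
    edgeVector i j ∈ cutFace G C := by
  classical
  refine mem_cutFace.2 ⟨?_, edgeVector_mem_dualEdgeCone hij⟩
  simp [cutVector, pairing_edgeVector, Set.indicator_apply, h]

/-- By duality: a linear form vanishing on all edge vectors is a potential balanced on every edge,
so it is zero. -/
theorem span_dualEdgeCone {G : SimpleGraph (Vert m n)}
    (hG : G ≤ completeBipartiteGraph (Fin m) (Fin n)) (hconn : G.Connected) :
    Submodule.span ℚ (dualEdgeCone G : Set (MQ m n)) = ⊤ := by
  rw [eq_top_iff]
  intro x _
  by_contra hx
  obtain ⟨f, hfx, hf⟩ := Submodule.exists_le_ker_of_notMem hx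
  obtain ⟨p, rfl⟩ := exists_potential f
  refine hfx ?_
  rw [LinearMap.flip_apply, potentialClass_eq_zero_of_connected hG hconn, map_zero]
  intro i j hij
  have := hf (Submodule.subset_span (edgeVector_mem_dualEdgeCone hij))
  rwa [LinearMap.mem_ker, LinearMap.flip_apply, pairing_edgeVector, sub_eq_zero] at this

namespace IsConnectedCut

variable {G : SimpleGraph (Vert m n)} {C : Set (Vert m n)}

/-- By duality: a form vanishing on the uncut edge vectors is a multiple of the cut vector, because
the parts are connected. -/
theorem span_cutFace (hC : IsConnectedCut G C)
    (hG : G ≤ completeBipartiteGraph (Fin m) (Fin n)) :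
    Submodule.span ℚ (cutFace G C : Set (MQ m n)) =
      LinearMap.ker ((pairing m n).flip (cutVector C)) := by
  refine le_antisymm (Submodule.span_le.2 fun x hx => (mem_cutFace.1 hx).1) fun x hx => ?_
  by_contra hx'
  obtain ⟨f, hfx, hf⟩ := Submodule.exists_le_ker_of_notMem hx'
  obtain ⟨p, rfl⟩ := exists_potential f
  obtain ⟨c, hc⟩ := hC.exists_potentialClass_eq_smul hG (p := p) fun i j hij h => by
    have := hf (Submodule.subset_span (edgeVector_mem_cutFace hij h))
    rwa [LinearMap.mem_ker, LinearMap.flip_apply, pairing_edgeVector, sub_eq_zero] at this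
  refine hfx ?_
  rw [hc, map_smul, LinearMap.smul_apply, LinearMap.mem_ker.1 hx, smul_zero]

/-- The cut vector is nonnegative on the dual cone, which makes its zero locus a face. A crossing
edge shows that the form is nonzero, so the span of the face is a hyperplane. -/
theorem isFacet_cutFace (hC : IsConnectedCut G C)
    (hG : G ≤ completeBipartiteGraph (Fin m) (Fin n)) (hconn : G.Connected) :
    IsFacet (cutFace G C) (dualEdgeCone G) := by
  refine ⟨⟨fun x hx => (mem_cutFace.1 hx).2, ?_⟩, ?_⟩
  · intro x y a hx hy ha hxy
    refine mem_cutFace.2 ⟨?_, hx⟩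
    have h1 := cutVector_mem_edgeCone hC.directed hx
    have h2 := cutVector_mem_edgeCone hC.directed hy
    have h3 := (mem_cutFace.1 hxy).1
    rw [map_add, map_smul, LinearMap.add_apply, LinearMap.smul_apply, smul_eq_mul] at h3
    have h4 : a * pairing m n x (cutVector C) ≤ 0 := by linarith
    exact le_antisymm (nonpos_of_mul_nonpos_right h4 ha) h1
  · obtain ⟨i, j, hij, hi, hj⟩ := hC.exists_crossing hG hconn
    have hne : (pairing m n).flip (cutVector C) ≠ 0 := fun h0 => by
      have := LinearMap.congr_fun h0 (edgeVector i j)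
      simp [cutVector, pairing_edgeVector, hi, hj] at this
    rw [coneDim, coneDim, hC.span_cutFace hG, span_dualEdgeCone hG hconn, finrank_top,
      Module.Dual.finrank_ker_add_one_of_ne_zero hne]

theorem dualFace_cutFace (hC : IsConnectedCut G C)
    (hG : G ≤ completeBipartiteGraph (Fin m) (Fin n)) (hconn : G.Connected) :
    dualFace G (cutFace G C) = cutRay C := by
  ext x
  rw [mem_dualFace]
  constructor
  · rintro ⟨h, hx⟩
    obtain ⟨p, rfl⟩ := potentialClass_surjective x
    refine hC.mem_cutRay_of_balanced hG hconn hx fun i j hij hcut => ?_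
    have := h _ (edgeVector_mem_cutFace hij hcut)
    rwa [pairing_edgeVector, sub_eq_zero] at this
  · intro hx
    refine ⟨fun y hy => ?_, (hC.cutRay_mem_extremalRays hG hconn).1.le hx⟩
    obtain ⟨c, -, rfl⟩ := mem_cutRay.1 hx
    rw [map_smul, (mem_cutFace.1 hy).1, smul_zero]

end IsConnectedCut

end

end EdgeCone

namespace EdgeCone

noncomputable section

variable {m n : ℕ}

/-! ### The two sides of the bipartition -/

@[simp] theorem inl_mem_U_zero (i : Fin m) : (Sum.inl i : Vert m n) ∈ U 0 := ⟨i, rfl⟩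

@[simp] theorem inr_mem_U_one (j : Fin n) : (Sum.inr j : Vert m n) ∈ U 1 := ⟨j, rfl⟩

@[simp] theorem inr_notMem_U_zero (j : Fin n) : (Sum.inr j : Vert m n) ∉ U 0 := by
  rintro ⟨i, h⟩
  cases h

@[simp] theorem inl_notMem_U_one (i : Fin m) : (Sum.inl i : Vert m n) ∉ U 1 := by
  rintro ⟨j, h⟩
  cases h

theorem mem_U_iff_notMem {i j : Fin 2} (hij : i ≠ j) {v : Vert m n} : v ∈ U j ↔ v ∉ U i := by
  fin_cases i <;> fin_cases j <;> rcases v with v | v <;> simp at hij ⊢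

theorem mem_U_of_adj {G : SimpleGraph (Vert m n)}
    (hG : G ≤ completeBipartiteGraph (Fin m) (Fin n)) {i j : Fin 2} (hij : i ≠ j)
    {u v : Vert m n} (hu : u ∈ U i) (huv : G.Adj u v) : v ∈ U j := by
  rcases exists_eq_inl_inr_of_adj hG huv with ⟨a, b, rfl, rfl⟩ | ⟨a, b, rfl, rfl⟩ <;>
    fin_cases i <;> fin_cases j <;> simp at hij hu ⊢

theorem exists_adj_of_reachable {V : Type*} {G : SimpleGraph V} {u v : V} (h : G.Reachable u v)
    (huv : u ≠ v) : ∃ w, G.Adj u w := by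
  obtain ⟨w⟩ := h
  cases w with
  | nil => exact absurd rfl huv
  | cons hadj _ => exact ⟨_, hadj⟩

/-! ### The cut of an independent set -/

/-- The cut of a vertex set `A`; its parts are `(U_1 \ A) ∪ (A ∩ U_2)` and
`(A ∩ U_1) ∪ (U_2 \ A)`. -/
def cutOf (A : Set (Vert m n)) : Set (Vert m n) := symmDiff A (U 0)

theorem cutOf_cutOf (A : Set (Vert m n)) : cutOf (cutOf A) = A :=
  symmDiff_symmDiff_cancel_right _ _

theorem cutOf_injective : Function.Injective (cutOf : Set (Vert m n) → Set (Vert m n)) :=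
  Function.LeftInverse.injective cutOf_cutOf

@[simp] theorem inl_mem_cutOf {A : Set (Vert m n)} {i : Fin m} :
    Sum.inl i ∈ cutOf A ↔ Sum.inl i ∉ A := by
  simp [cutOf, Set.mem_symmDiff]

@[simp] theorem inr_mem_cutOf {A : Set (Vert m n)} {j : Fin n} :
    Sum.inr j ∈ cutOf A ↔ Sum.inr j ∈ A := by
  simp [cutOf, Set.mem_symmDiff]

theorem cutOf_iff_of_ne {A : Set (Vert m n)} {i j : Fin 2} (hij : i ≠ j) {u v : Vert m n}
    (hu : u ∈ U i) (hv : v ∈ U j) : (u ∈ cutOf A ↔ v ∈ cutOf A) ↔ (u ∈ A ↔ v ∉ A) := by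
  rcases u with u | u <;> rcases v with v | v <;> fin_cases i <;> fin_cases j <;>
    simp at hij hu hv ⊢
  tauto

theorem cutOf_iff_of_same {A : Set (Vert m n)} {i : Fin 2} {u v : Vert m n}
    (hu : u ∈ U i) (hv : v ∈ U i) : (u ∈ cutOf A ↔ v ∈ cutOf A) ↔ (u ∈ A ↔ v ∈ A) := by
  rcases u with u | u <;> rcases v with v | v <;> fin_cases i <;> simp at hu hv ⊢
  tauto

theorem IsIndep.not_adj {G : SimpleGraph (Vert m n)} {A : Set (Vert m n)} (hA : IsIndep G A)
    {u v : Vert m n} (hu : u ∈ A) (hv : v ∈ A) : ¬ G.Adj u v :=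
  fun h => hA.2 hu hv h.ne h

theorem isIndep_of_mem_starIndependentSets {G : SimpleGraph (Vert m n)} {A : Set (Vert m n)}
    (hA : A ∈ starIndependentSets G) : IsIndep G A := by
  rcases hA with h | h
  · exact h.1.1
  · exact h.1

theorem IsIndep.insert {G : SimpleGraph (Vert m n)}
    (hG : G ≤ completeBipartiteGraph (Fin m) (Fin n)) {A : Set (Vert m n)} (hA : IsIndep G A)
    {i j : Fin 2} (hij : i ≠ j) {v : Vert m n} (hv : v ∈ U j) (hv' : v ∉ nbr G (A ∩ U i)) :
    IsIndep G (insert v A) := by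
  refine ⟨Set.insert_nonempty _ _, ?_⟩
  have key : ∀ a ∈ A, ¬ G.Adj v a := fun a ha h =>
    hv' ⟨a, ⟨ha, mem_U_of_adj hG hij.symm hv h⟩, h.symm⟩
  rintro a (rfl | ha) b (rfl | hb) hab
  · exact absurd rfl hab
  · exact key b hb
  · exact fun h => key a ha h.symm
  · exact hA.2 ha hb hab

/-! ### Sets in `ℐ_G^{(*)}`: neighbors, associated subgraph and hyperplanes -/

section Star

variable {G : SimpleGraph (Vert m n)} {A : Set (Vert m n)}

/-- The neighbors of one side of a set in `ℐ_G^{(*)}` are all vertices of the other side that are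
not in the set. -/
theorem nbr_inter_U (hG : G ≤ completeBipartiteGraph (Fin m) (Fin n)) (hconn : G.Connected)
    (hA : A ∈ starIndependentSets G) {i j : Fin 2} (hij : i ≠ j) (hne : (A ∩ U i).Nonempty) :
    nbr G (A ∩ U i) = U j \ A := by
  have hind := isIndep_of_mem_starIndependentSets hA
  refine Set.Subset.antisymm ?_ ?_
  · rintro v ⟨a, ⟨ha, hai⟩, hav⟩
    exact ⟨mem_U_of_adj hG hij hai hav, fun hv => hind.not_adj ha hv hav⟩
  · rintro v ⟨hv, hvA⟩
    by_contra hvn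
    have hins := hind.insert hG hij hv hvn
    rcases hA with ⟨-, hmax⟩ | ⟨-, ⟨k, u, hu, hAu⟩, hno⟩
    · exact hvA (hmax.2 hins (Set.subset_insert v A) (Set.mem_insert v A))
    · obtain ⟨a, ha, hai⟩ := hne
      have hk : k = i := by
        by_contra hki
        exact (mem_U_iff_notMem hki).1 hai (hAu ▸ ha : a ∈ U k \ {u}).1
      subst hk
      have hvk : v ∉ U k := (mem_U_iff_notMem hij).1 hv
      -- The enlarged set is two-sided: it still misses `u` in `U_k`, and on the other side it
      -- misses a neighbor of `a`.
      refine hno ⟨insert v A, ⟨hins, fun l => ?_⟩, Set.subset_insert v A⟩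
      by_cases hl : k = l
      · subst hl
        refine ⟨⟨a, Or.inr ha, hai⟩, Set.inter_subset_right, fun h => ?_⟩
        rcases (h hu).1 with rfl | h'
        · exact hvk hu
        · rw [hAu] at h'
          exact h'.2 rfl
      · have hlj : l = j := by omega
        subst hlj
        refine ⟨⟨v, Or.inl rfl, hv⟩, Set.inter_subset_right, fun h => ?_⟩
        have hav : a ≠ v := fun h => hvk (h ▸ hai)
        obtain ⟨w, hw⟩ := exists_adj_of_reachable (hconn.preconnected a v) hav
        rcases (h (mem_U_of_adj hG hij hai hw)).1 with rfl | h'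
        · exact hvn ⟨a, ⟨ha, hai⟩, hw⟩
        · exact hind.not_adj ha h' hw

theorem cutOf_nonempty (hA : A ∈ starIndependentSets G) : (cutOf A).Nonempty := by
  rcases hA with ⟨⟨-, h⟩, -⟩ | ⟨⟨⟨a, ha⟩, -⟩, ⟨k, u, hu, rfl⟩, -⟩
  · obtain ⟨v, hv, hv'⟩ := Set.exists_of_ssubset (h 0).2
    rcases v with v | v <;> simp at hv hv'
    exact ⟨_, inl_mem_cutOf.2 hv'⟩
  · fin_cases k
    · rcases u with u | u <;> simp at hu
      exact ⟨Sum.inl u, by simp⟩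
    · rcases a with a | a
      · simp at ha
      · exact ⟨Sum.inr a, inr_mem_cutOf.2 ha⟩

theorem cutOf_compl_nonempty (hA : A ∈ starIndependentSets G) : (cutOf A)ᶜ.Nonempty := by
  rcases hA with ⟨⟨-, h⟩, -⟩ | ⟨⟨⟨a, ha⟩, -⟩, ⟨k, u, hu, rfl⟩, -⟩
  · obtain ⟨v, hv, hv'⟩ := Set.exists_of_ssubset (h 1).2
    rcases v with v | v <;> simp at hv hv'
    exact ⟨Sum.inr v, by simpa using hv'⟩
  · fin_cases k
    · rcases a with a | a
      · exact ⟨Sum.inl a, fun h => inl_mem_cutOf.1 h ha⟩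
      · simp at ha
    · rcases u with u | u <;> simp at hu
      exact ⟨Sum.inr u, by simp⟩

theorem assocSubgraph_eq_cutGraph (hG : G ≤ completeBipartiteGraph (Fin m) (Fin n))
    (hconn : G.Connected) (hA : A ∈ starIndependentSets G) :
    assocSubgraph G A = cutGraph G (cutOf A) := by
  have hne := (isIndep_of_mem_starIndependentSets hA).1
  have h01 := fun h => nbr_inter_U hG hconn hA (i := 0) (j := 1) (by decide) h
  have h10 := fun h => nbr_inter_U hG hconn hA (i := 1) (j := 0) (by decide) h
  rw [assocSubgraph, cutGraph]
  split_ifs with h0 h1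
  · have hA0 : A ∩ U 0 = A := Set.inter_eq_left.2 h0
    rw [hA0] at h01
    rw [h01 hne, sup_comm]
    congr 2
    · ext v
      rcases v with v | v
      · simp
      · simp
    · ext v
      rcases v with v | v
      · simp
      · simpa using fun h => inr_notMem_U_zero v (h0 h)
  · have hA1 : A ∩ U 1 = A := Set.inter_eq_left.2 h1
    rw [hA1] at h10
    rw [h10 hne]
    congr 2
    · ext v
      rcases v with v | v
      · have : Sum.inl v ∉ A := fun h => inl_notMem_U_one v (h1 h)
        simp [this]
      · simp
    · ext v
      rcases v with v | v
      · simp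
      · simp
  · obtain ⟨a, ha, ha0⟩ := Set.not_subset.1 h0
    obtain ⟨b, hb, hb1⟩ := Set.not_subset.1 h1
    rw [h01 ⟨b, hb, (mem_U_iff_notMem (by decide)).2 hb1⟩,
      h10 ⟨a, ha, (mem_U_iff_notMem (by decide)).2 ha0⟩, sup_comm]
    congr 2
    · ext v
      rcases v with v | v <;> simp
    · ext v
      rcases v with v | v <;> simp

/-- The face of the dual edge cone attached to either side of a set in `ℐ_G^{(*)}` is the one
attached to its cut. -/
theorem hyperplaneFace_eq_cutFace (hG : G ≤ completeBipartiteGraph (Fin m) (Fin n))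
    (hconn : G.Connected) (hA : A ∈ starIndependentSets G) {i : Fin 2}
    (hne : (A ∩ U i).Nonempty) : hyperplaneFace G (A ∩ U i) = cutFace G (cutOf A) := by
  classical
  rw [hyperplaneFace, cutFace]
  congr 2
  ext x
  have hx : ∑ i, (x : Vert m n → ℚ) (Sum.inl i) = ∑ j, (x : Vert m n → ℚ) (Sum.inr j) := by
    have := x.2
    simpa [MQ, oneNegOne, dotProduct, ← sub_eq_add_neg, sub_eq_zero] using this
  have hsum : ∀ S : Set (Vert m n), sumOver S x =
      ∑ i, (if Sum.inl i ∈ S then (x : Vert m n → ℚ) (Sum.inl i) else 0) +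
        ∑ j, (if Sum.inr j ∈ S then (x : Vert m n → ℚ) (Sum.inr j) else 0) := by
    intro S
    simp [sumOver, dotProduct, Set.indicator_apply]
  have hpair : pairing m n x (cutVector (cutOf A)) =
      ∑ i, (if Sum.inl i ∈ A then 0 else (x : Vert m n → ℚ) (Sum.inl i)) -
        ∑ j, (if Sum.inr j ∈ A then (x : Vert m n → ℚ) (Sum.inr j) else 0) := by
    simp [cutVector, pairing_potentialClass, Set.indicator_apply]
  have hl : ∑ i, (x : Vert m n → ℚ) (Sum.inl i) =
      ∑ i, (if Sum.inl i ∈ A then (x : Vert m n → ℚ) (Sum.inl i) else 0) +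
        ∑ i, (if Sum.inl i ∈ A then 0 else (x : Vert m n → ℚ) (Sum.inl i)) := by
    rw [← Finset.sum_add_distrib]
    exact Finset.sum_congr rfl fun i _ => by split_ifs <;> simp
  have hr : ∑ j, (x : Vert m n → ℚ) (Sum.inr j) =
      ∑ j, (if Sum.inr j ∈ A then (x : Vert m n → ℚ) (Sum.inr j) else 0) +
        ∑ j, (if Sum.inr j ∈ A then 0 else (x : Vert m n → ℚ) (Sum.inr j)) := by
    rw [← Finset.sum_add_distrib]
    exact Finset.sum_congr rfl fun i _ => by split_ifs <;> simp
  -- The kernel condition says that the sums over `U_1 \ A` and `A_2` agree. Since the totals over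
  -- `U_1` and `U_2` are equal on `M_ℚ`, this is the same as equality of the sums over `A_1` and
  -- `U_2 \ A`.
  rw [hyperplane, LinearMap.mem_eqLocus, LinearMap.mem_ker, LinearMap.flip_apply, hpair]
  obtain rfl | rfl : i = 0 ∨ i = 1 := by omega
  · rw [nbr_inter_U hG hconn hA (j := 1) (by decide) hne, hsum, hsum]
    simp only [Set.mem_inter_iff, inl_mem_U_zero, and_true, inr_notMem_U_zero, and_false, if_false,
      Finset.sum_const_zero, add_zero, Set.mem_sdiff, inl_notMem_U_one, false_and, inr_mem_U_one,
      true_and, zero_add, ite_not]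
    constructor <;> intro h <;> linarith
  · rw [nbr_inter_U hG hconn hA (j := 0) (by decide) hne, hsum, hsum]
    simp only [Set.mem_inter_iff, inl_mem_U_zero, and_true, inr_notMem_U_zero, and_false, if_false,
      Finset.sum_const_zero, add_zero, Set.mem_sdiff, inl_notMem_U_one, false_and, inr_mem_U_one,
      true_and, zero_add, ite_not]
    constructor <;> intro h <;> linarith

end Star

/-! ### First independent sets and connected cuts -/

/-- Membership in `C` is constant on components and defines a surjection from them onto the
two-element type `Prop`; having two components amounts to its injectivity. -/
theorem card_connectedComponent_cutGraph {G : SimpleGraph (Vert m n)} {C : Set (Vert m n)}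
    (hC : C.Nonempty) (hC' : Cᶜ.Nonempty) :
    Nat.card (cutGraph G C).ConnectedComponent = 2 ↔
      ∀ u v, (u ∈ C ↔ v ∈ C) → (cutGraph G C).Reachable u v := by
  classical
  have hlift : ∀ u v, (cutGraph G C).Reachable u v → (u ∈ C) = (v ∈ C) := fun u v =>
    apply_eq_of_reachable (p := fun v => v ∈ C) fun u v h => propext (cutGraph_adj.1 h).2
  let f : (cutGraph G C).ConnectedComponent → Prop :=
    SimpleGraph.ConnectedComponent.lift (fun v => v ∈ C) fun u v p _ => hlift u v ⟨p⟩
  have hsurj : Function.Surjective f := by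
    intro P
    by_cases hP : P
    · obtain ⟨u, hu⟩ := hC
      exact ⟨(cutGraph G C).connectedComponentMk u, by simp [f, hP, hu]⟩
    · obtain ⟨u, hu⟩ := hC'
      exact ⟨(cutGraph G C).connectedComponentMk u, by simpa [f, hP] using hu⟩
  have hProp : Nat.card Prop = 2 := by simp
  constructor
  · intro hcard u v huv
    have hinj := (hsurj.bijective_of_nat_card_le (by rw [hcard, hProp])).1
    exact SimpleGraph.ConnectedComponent.exact (hinj (by simpa [f] using huv))
  · intro h
    rw [← hProp]
    refine Nat.card_eq_of_bijective f ⟨?_, hsurj⟩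
    intro x y
    refine SimpleGraph.ConnectedComponent.ind₂ (fun u v huv => ?_) x y
    exact SimpleGraph.ConnectedComponent.sound (h u v (by simpa [f] using huv))

theorem isConnectedCut_cutOf {G : SimpleGraph (Vert m n)}
    (hG : G ≤ completeBipartiteGraph (Fin m) (Fin n)) (hconn : G.Connected)
    {A : Set (Vert m n)} (hA : A ∈ firstIndependentSets G) : IsConnectedCut G (cutOf A) where
  nonempty := cutOf_nonempty hA.1
  nonempty_compl := cutOf_compl_nonempty hA.1
  directed _ _ hij hj := inl_mem_cutOf.2 fun hi =>
    (isIndep_of_mem_starIndependentSets hA.1).not_adj hi (inr_mem_cutOf.1 hj) hij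
  reachable := (card_connectedComponent_cutGraph (cutOf_nonempty hA.1)
    (cutOf_compl_nonempty hA.1)).1 (assocSubgraph_eq_cutGraph hG hconn hA.1 ▸ hA.2)

/-! ### From connected cuts to first independent sets -/

section Converse

variable {G : SimpleGraph (Vert m n)} {A : Set (Vert m n)}

/-- The vertex `v` lies in the same part as any element of `A ∩ U i`, so it has an uncut edge; as
its ends are on opposite sides, exactly one of them is in `A`. -/
theorem IsConnectedCut.exists_adj_of_notMem (hC : IsConnectedCut G (cutOf A))
    (hG : G ≤ completeBipartiteGraph (Fin m) (Fin n)) {i j : Fin 2} (hij : i ≠ j)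
    (hne : (A ∩ U i).Nonempty) {v : Vert m n} (hv : v ∈ U j) (hvA : v ∉ A) :
    ∃ z ∈ A, G.Adj v z := by
  obtain ⟨a, ha, hai⟩ := hne
  have hva : v ≠ a := fun h => hvA (h ▸ ha)
  obtain ⟨z, hz⟩ := exists_adj_of_reachable
    (hC.reachable v a ((cutOf_iff_of_ne hij.symm hv hai).2 (by simp [hvA, ha]))) hva
  rw [cutGraph_adj] at hz
  have := (cutOf_iff_of_ne hij.symm hv (mem_U_of_adj hG hij.symm hv hz.1)).1 hz.2
  exact ⟨z, by tauto, hz.1⟩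

theorem IsConnectedCut.exists_mem_of_same_side (hC : IsConnectedCut G (cutOf A))
    (hG : G ≤ completeBipartiteGraph (Fin m) (Fin n)) {i j : Fin 2} (hij : i ≠ j)
    {u v : Vert m n} (hu : u ∈ U i) (hv : v ∈ U i) (huA : u ∉ A) (hvA : v ∉ A) (huv : u ≠ v) :
    ∃ z ∈ A, z ∈ U j := by
  obtain ⟨z, hz⟩ := exists_adj_of_reachable
    (hC.reachable u v ((cutOf_iff_of_same hu hv).2 (by simp [huA, hvA]))) huv
  rw [cutGraph_adj] at hz
  have hzj := mem_U_of_adj hG hij hu hz.1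
  have := (cutOf_iff_of_ne hij hu hzj).1 hz.2
  exact ⟨z, by tauto, hzj⟩

theorem IsConnectedCut.exists_mem_U_diff (hC : IsConnectedCut G (cutOf A)) {i : Fin 2}
    (hA : A ⊆ U i) : ∃ u ∈ U i, u ∉ A := by
  by_contra! h
  have hAi : A = U i := Set.Subset.antisymm hA h
  subst hAi
  obtain ⟨u, hu⟩ := hC.nonempty
  obtain ⟨v, hv⟩ := hC.nonempty_compl
  fin_cases i <;> rcases u with u | u <;> rcases v with v | v <;> simp at hu hv

theorem IsConnectedCut.isIndep (hC : IsConnectedCut G (cutOf A))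
    (hG : G ≤ completeBipartiteGraph (Fin m) (Fin n)) (hne : ¬ (m = 1 ∧ n = 1)) :
    IsIndep G A := by
  constructor
  · by_contra hA
    rw [Set.not_nonempty_iff_eq_empty] at hA
    subst hA
    -- For `A = ∅` the parts are the two sides and every edge crosses, so connectedness allows only
    -- one vertex on each side.
    have hsub : ∀ i j : Fin 2, i ≠ j → ∀ u ∈ U i, ∀ v ∈ (U i : Set (Vert m n)), u = v := by
      intro i j hij u hu v hv
      by_contra huv
      obtain ⟨z, hz, -⟩ := hC.exists_mem_of_same_side hG hij hu hv (by simp) (by simp) huv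
      exact hz
    obtain ⟨u, hu⟩ := hC.nonempty
    obtain ⟨v, hv⟩ := hC.nonempty_compl
    rcases u with u | u
    swap
    · simp at hu
    rcases v with v | v
    · simp at hv
    refine hne ⟨?_, ?_⟩
    · have : Subsingleton (Fin m) := ⟨fun a b => Sum.inl_injective
        (hsub 0 1 (by decide) (Sum.inl a) (by simp) (Sum.inl b) (by simp))⟩
      have h1 := Fin.subsingleton_iff_le_one.1 this
      have h2 := u.pos
      omega
    · have : Subsingleton (Fin n) := ⟨fun a b => Sum.inr_injective
        (hsub 1 0 (by decide) (Sum.inr a) (by simp) (Sum.inr b) (by simp))⟩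
      have h1 := Fin.subsingleton_iff_le_one.1 this
      have h2 := v.pos
      omega
  · intro u hu v hv _ huv
    rcases exists_eq_inl_inr_of_adj hG huv with ⟨i, j, rfl, rfl⟩ | ⟨i, j, rfl, rfl⟩
    · exact inl_mem_cutOf.1 (hC.directed i j huv (inr_mem_cutOf.2 hv)) hu
    · exact inl_mem_cutOf.1 (hC.directed i j huv.symm (inr_mem_cutOf.2 hu)) hv

theorem IsConnectedCut.mem_starIndependentSets (hC : IsConnectedCut G (cutOf A))
    (hG : G ≤ completeBipartiteGraph (Fin m) (Fin n)) (hconn : G.Connected)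
    (hne : ¬ (m = 1 ∧ n = 1)) : A ∈ starIndependentSets G := by
  have hind := hC.isIndep hG hne
  by_cases hboth : ∀ i, (A ∩ U i).Nonempty
  · refine Or.inl ⟨⟨hind, fun i => ⟨hboth i, Set.inter_subset_right, fun h => ?_⟩⟩, hind, ?_⟩
    -- If `A` contained all of `U i`, a vertex of `A` on the other side would have a neighbor in
    -- `A`.
    · obtain ⟨j, hij⟩ : ∃ j, i ≠ j := (exists_ne i).imp fun _ h => h.symm
      obtain ⟨w, hw, hwj⟩ := hboth j
      obtain ⟨a, ha, hai⟩ := hboth i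
      have hwa : w ≠ a := fun h => (mem_U_iff_notMem hij).1 hwj (h ▸ hai)
      obtain ⟨z, hz⟩ := exists_adj_of_reachable (hconn.preconnected w a) hwa
      exact hind.not_adj hw (h (mem_U_of_adj hG hij.symm hwj hz)).1 hz
    · intro B hB hAB v hv
      by_contra hvA
      have hex : ∃ i j : Fin 2, i ≠ j ∧ v ∈ U j := by
        rcases v with v | v
        · exact ⟨1, 0, by decide, by simp⟩
        · exact ⟨0, 1, by decide, by simp⟩
      obtain ⟨i, j, hij, hvj⟩ := hex
      obtain ⟨z, hz, hvz⟩ := hC.exists_adj_of_notMem hG hij (hboth i) hvj hvA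
      exact hB.not_adj hv (hAB hz) hvz
  · push Not at hboth
    obtain ⟨j, hj⟩ := hboth
    obtain ⟨i, hji⟩ : ∃ i, j ≠ i := (exists_ne j).imp fun _ h => h.symm
    have hAi : A ⊆ U i := fun v hv => (mem_U_iff_notMem hji).2 fun hvj =>
      (Set.eq_empty_iff_forall_notMem.1 hj) v ⟨hv, hvj⟩
    obtain ⟨u, hu, huA⟩ := hC.exists_mem_U_diff hAi
    refine Or.inr ⟨hind, ⟨i, u, hu, ?_⟩, ?_⟩
    · refine Set.Subset.antisymm (fun v hv => ⟨hAi hv, fun h => huA (h ▸ hv)⟩) ?_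
      -- Two vertices of `U i` outside `A` would lie in the same part, and joining them by uncut
      -- edges would need an element of `A` on the empty side.
      rintro v ⟨hv, hvu⟩
      by_contra hvA
      obtain ⟨z, hz, hzj⟩ := hC.exists_mem_of_same_side hG hji.symm hv hu hvA huA hvu
      exact (Set.eq_empty_iff_forall_notMem.1 hj) z ⟨hz, hzj⟩
    · rintro ⟨B, hB, hAB⟩
      obtain ⟨w, hw, hwj⟩ := (hB.2 j).1
      obtain ⟨z, hz, hwz⟩ := hC.exists_adj_of_notMem hG hji.symm
        (by rw [Set.inter_eq_left.2 hAi]; exact hind.1) hwj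
        (fun h => (mem_U_iff_notMem hji.symm).1 hwj (hAi h))
      exact hB.1.not_adj hw (hAB hz) hwz

theorem IsConnectedCut.mem_firstIndependentSets (hC : IsConnectedCut G (cutOf A))
    (hG : G ≤ completeBipartiteGraph (Fin m) (Fin n)) (hconn : G.Connected)
    (hne : ¬ (m = 1 ∧ n = 1)) : A ∈ firstIndependentSets G := by
  have hA := hC.mem_starIndependentSets hG hconn hne
  refine ⟨hA, ?_⟩
  rw [assocSubgraph_eq_cutGraph hG hconn hA]
  exact (card_connectedComponent_cutGraph hC.nonempty hC.nonempty_compl).2 hC.reachable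

end Converse

/-- The generator of the ray of a cut is determined by that ray, so cuts with the same ray
coincide. -/
theorem cutRay_inj {C D : Set (Vert m n)} (hC : C.Nonempty) (hC' : Cᶜ.Nonempty)
    (hD : D.Nonempty) (hD' : Dᶜ.Nonempty) (h : cutRay C = cutRay D) : C = D :=
  cutVector_inj hC hC' hD hD'
    ((isRayGenerator_cutVector hC hC').unique (h ▸ isRayGenerator_cutVector hD hD'))

end

end EdgeCone

open EdgeCone in
theorem mainTheorem5 (m n : ℕ) (G : SimpleGraph (Fin m ⊕ Fin n))
    (hG : G ≤ completeBipartiteGraph (Fin m) (Fin n)) (hconn : G.Connected)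
    (hne : ¬ (m = 1 ∧ n = 1)) :
    ∃ (π : EdgeCone.firstIndependentSets G ≃ EdgeCone.extremalRays G)
      (γ : EdgeCone.firstIndependentSets G ≃ EdgeCone.extremalGenerators G),
      (∀ (A : EdgeCone.firstIndependentSets G) (i : Fin 2),
        ((A : Set (Fin m ⊕ Fin n)) ∩ EdgeCone.U i).Nonempty →
          EdgeCone.IsFacet
            (EdgeCone.hyperplaneFace G ((A : Set (Fin m ⊕ Fin n)) ∩ EdgeCone.U i))
            (EdgeCone.dualEdgeCone G) ∧
          (π A : PointedCone ℚ (EdgeCone.NQ m n)) =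
            EdgeCone.dualFace G
              (EdgeCone.hyperplaneFace G ((A : Set (Fin m ⊕ Fin n)) ∩ EdgeCone.U i))) ∧
      (∀ A : EdgeCone.firstIndependentSets G,
        EdgeCone.IsRayGenerator
          (π A : PointedCone ℚ (EdgeCone.NQ m n)) (γ A : EdgeCone.NQ m n)) := by
  have hcut : ∀ A : firstIndependentSets G, IsConnectedCut G (cutOf (A : Set (Vert m n))) :=
    fun A => isConnectedCut_cutOf hG hconn A.2
  have hfirst : ∀ C, IsConnectedCut G C → cutOf C ∈ firstIndependentSets G := fun C hC =>
    IsConnectedCut.mem_firstIndependentSets (by rwa [cutOf_cutOf]) hG hconn hne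
  have hgen : ∀ A : firstIndependentSets G, IsRayGenerator (cutRay (cutOf (A : Set (Vert m n))))
      (cutVector (cutOf (A : Set (Vert m n)))) := fun A =>
    isRayGenerator_cutVector (hcut A).nonempty (hcut A).nonempty_compl
  let π₀ : firstIndependentSets G → extremalRays G := fun A =>
    ⟨cutRay (cutOf (A : Set (Vert m n))), (hcut A).cutRay_mem_extremalRays hG hconn⟩
  let γ₀ : firstIndependentSets G → extremalGenerators G := fun A =>
    ⟨cutVector (cutOf (A : Set (Vert m n))), _, (π₀ A).2, hgen A⟩
  have hπ : Function.Bijective π₀ := by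
    constructor
    · intro A B h
      exact Subtype.ext (cutOf_injective (cutRay_inj (hcut A).nonempty (hcut A).nonempty_compl
        (hcut B).nonempty (hcut B).nonempty_compl (congrArg Subtype.val h)))
    · rintro ⟨ρ, hρ⟩
      obtain ⟨C, hC, rfl⟩ := exists_isConnectedCut_of_mem_extremalRays hG hconn hρ
      exact ⟨⟨cutOf C, hfirst C hC⟩, Subtype.ext (congrArg cutRay (cutOf_cutOf C))⟩
  have hγ : Function.Bijective γ₀ := by
    constructor
    · intro A B h
      exact Subtype.ext (cutOf_injective (cutVector_inj (hcut A).nonempty (hcut A).nonempty_compl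
        (hcut B).nonempty (hcut B).nonempty_compl (congrArg Subtype.val h)))
    · rintro ⟨v, ρ, hρ, hv⟩
      -- An arbitrary generator of `ρ` is the cut vector, since ray generators are unique.
      obtain ⟨A, hA⟩ := hπ.2 ⟨ρ, hρ⟩
      have hA' : cutRay (cutOf (A : Set (Vert m n))) = ρ := congrArg Subtype.val hA
      exact ⟨A, Subtype.ext ((hgen A).unique (hA' ▸ hv))⟩
  refine ⟨Equiv.ofBijective π₀ hπ, Equiv.ofBijective γ₀ hγ, fun A i hi => ?_, hgen⟩
  rw [hyperplaneFace_eq_cutFace hG hconn A.2.1 hi]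
  exact ⟨(hcut A).isFacet_cutFace hG hconn, ((hcut A).dualFace_cutFace hG hconn).symm⟩
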